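/- Let $p$ be an odd prime, let $V$ be a vector space of finite dimension $2n$ over $\mathbf F_p$, and let $f\colon V\times V\to\mathbf F_p$ be a nondegenerate alternating bilinear form. Let $E(f)=V\times\mathbf F_p$ be the group with multiplication $(x_1,z_1)(x_2,z_2)=(x_1+x_2,\,z_1+z_2+f(x_1,x_2))$, and let $G(f)$ be the group of all $g\in\mathrm{GL}(V)$ (acting on the right, so $x(gh)=(xg)h$) with $f(xg,yg)=f(x,y)$ for all $x,y\in V$, i.e. $G(f)=\mathrm{Sp}(V)$. Let $K'$ be a field containing a primitive $p$-th root of unity $\epsilon$, write $\exp(t)=\epsilon^t$ for $t\in\mathbf F_p$, let $V'$ be a $K'$-space of dimension $p^n$, and let $\rho\colon E(f)\to\mathrm{GL}(V')$ be an absolutely irreducible representation with $\rho(0,z)=\exp(z)\cdot 1$ for all $z\in\mathbf F_p$. For $g\in G(f)$ put $$s(g)=|V|^{-1}\sum_{y\in V}\rho(y,0)\rho(yg,0)^{-1},\qquad I(g)=V(1-g),\qquad i(g)=\dim I(g),$$ and let $f_g$ be the (well-defined) bilinear form on $I(g)$ with $f_g(x,y)=f(u,y)$ whenever $x=u(1-g)$.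 For $g,h\in G(f)$ let $$\sigma(g,h)=|I(g)|^{-1}|I(h)|^{-1}|I(gh)|\sum_{x\in I(g)\cap I(h^{-1})}\exp\bigl(f_g(x,x)-f_{h^{-1}}(x,x)\bigr).$$ Let $\chi$ be the quadratic character of $\mathbf F_p$, let $\delta_g=\chi(\det M)$ where $M$ is the matrix of $f_g$ relative to any basis of $I(g)$ (with $\det M=1$ if $I(g)=0$), let $\theta=\sum_{a\in\mathbf F_p}\exp(a^2)$, and define $\mu\colon G(f)\to K'$ by $$\mu(g)=|I(g)|^{-1}\theta^{i(g)}\delta_g .$$ Then every $s(g)$ is invertible and $\sigma$ is the factor set of the projective representation $s$ of $G(f)$, that is, $s(g)s(h)=\sigma(g,h)s(gh)$ for all $g,h\in G(f)$; and $\mu$ splits $\sigma$, that is, $\mu(g)\neq0$ for all $g\in G(f)$ and $$\sigma(g,h)=\mu(g)\mu(h)\mu(gh)^{-1}\qquad\text{for all }g,h\in G(f).$$ Furthermore, if $\eta'$ is an automorphism of $K'$ with $\epsilon^{\eta'}=\epsilon^{-1}$, then $\mu(g)=\mu(g^{-1})^{\eta'}$ for all $g\in G(f)$. -/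

import Mathlib

universe u

namespace Weil

open scoped TensorProduct

noncomputable section

variable {p : ℕ} {V : Type*} [AddCommGroup V] [Module (ZMod p) V]

/-- The group `E(f) = V × F_p` with `(x₁, z₁)(x₂, z₂) = (x₁ + x₂, z₁ + z₂ + f(x₁, x₂))`. -/
@[ext]
structure Extraspecial (f : LinearMap.BilinForm (ZMod p) V) where
  vec : V
  cen : ZMod p

namespace Extraspecial

variable {f : LinearMap.BilinForm (ZMod p) V}

instance : Mul (Extraspecial f) := ⟨fun a b => ⟨a.vec + b.vec, a.cen + b.cen + f a.vec b.vec⟩⟩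

instance : One (Extraspecial f) := ⟨⟨0, 0⟩⟩

instance : Inv (Extraspecial f) := ⟨fun a => ⟨-a.vec, -a.cen + f a.vec a.vec⟩⟩

@[simp] theorem mul_vec (a b : Extraspecial f) : (a * b).vec = a.vec + b.vec := rfl
@[simp] theorem mul_cen (a b : Extraspecial f) :
    (a * b).cen = a.cen + b.cen + f a.vec b.vec := rfl
@[simp] theorem one_vec : (1 : Extraspecial f).vec = 0 := rfl
@[simp] theorem one_cen : (1 : Extraspecial f).cen = 0 := rfl
@[simp] theorem inv_vec (a : Extraspecial f) : (a⁻¹).vec = -a.vec := rfl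
@[simp] theorem inv_cen (a : Extraspecial f) : (a⁻¹).cen = -a.cen + f a.vec a.vec := rfl

instance : Group (Extraspecial f) :=
  Group.ofLeftAxioms
    (fun a b c => by
      ext
      · simp [add_assoc]
      · simp; ring)
    (fun a => by ext <;> simp)
    (fun a => by ext <;> simp)

end Extraspecial

/-- The group `G(f)` of all `F_p`-linear automorphisms of `V` that preserve `f`. Its elements act
on `V` from the right, which is why it is a subgroup of the opposite of `V ≃ₗ V`:
`x g` is `g.unop x`, and `x (g h) = (x g) h`. -/
def isometryGroup (f : LinearMap.BilinForm (ZMod p) V) : Subgroup (V ≃ₗ[ZMod p] V)ᵐᵒᵖ where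
  carrier := {g | ∀ x y, f (g.unop x) (g.unop y) = f x y}
  mul_mem' := by
    intro g h hg hh x y
    simp only [Set.mem_ofPred_eq] at hg hh
    simp [hg, hh]
  one_mem' := by intro x y; simp
  inv_mem' := by
    intro g hg x y
    simp only [Set.mem_ofPred_eq] at hg
    rw [← hg]
    simp [MulOpposite.unop_inv, LinearEquiv.coe_inv]

variable {f : LinearMap.BilinForm (ZMod p) V}

/-- The right action `x ↦ x g` of `g ∈ G(f)` on `V`. -/
def act (g : isometryGroup f) : V →ₗ[ZMod p] V := (g.1.unop : V →ₗ[ZMod p] V)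

theorem act_preserves (g : isometryGroup f) (x y : V) : f (act g x) (act g y) = f x y := g.2 x y

theorem act_mul (g h : isometryGroup f) (x : V) : act (g * h) x = act h (act g x) := rfl

/-- `I(g)`, the image of `1 - g`. -/
abbrev image (g : isometryGroup f) : Submodule (ZMod p) V :=
  LinearMap.range (LinearMap.id - act g)

/-- `i(g) = dim I(g)`. -/
def imageDim (g : isometryGroup f) : ℕ := Module.finrank (ZMod p) (image g)

theorem ker_le (g : isometryGroup f) :
    LinearMap.ker (LinearMap.id - act g) ≤ LinearMap.ker (f.compl₂ (image g).subtype) := by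
  intro x hx
  rw [LinearMap.mem_ker, LinearMap.sub_apply, LinearMap.id_apply, sub_eq_zero] at hx
  rw [LinearMap.mem_ker]
  ext ⟨_, v, rfl⟩
  have h := act_preserves g x v
  rw [← hx] at h
  simp [h]

/-- The form `f_g` on `I(g)`: `f_g(u(1 - g), y) = f(u, y)`. -/
def wallForm (g : isometryGroup f) : LinearMap.BilinForm (ZMod p) (image g) :=
  ((LinearMap.ker (LinearMap.id - act g)).liftQ (f.compl₂ (image g).subtype) (ker_le g)).comp
    (LinearMap.id - act g).quotKerEquivRange.symm.toLinearMap

/-- The defining property of `f_g`. -/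
theorem wallForm_apply (g : isometryGroup f) (u : V) (x y : image g)
    (hx : (x : V) = u - act g u) : wallForm g x y = f u y := by
  have hx' : x = ⟨(LinearMap.id - act g : V →ₗ[ZMod p] V) u, ⟨u, rfl⟩⟩ := Subtype.ext hx
  subst hx'
  simp only [wallForm, LinearMap.comp_apply, LinearEquiv.coe_coe]
  erw [LinearMap.quotKerEquivRange_symm_apply_image]
  simp

/-- `δ_g = χ(det M)`, with `χ` the quadratic character of `F_p` and `M` the matrix of `f_g`
relative to a basis of `I(g)`; `wallSign_eq` shows that the basis does not matter. -/
def wallSign [Fact p.Prime] [Finite V] (g : isometryGroup f) : ℤ :=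
  quadraticChar (ZMod p)
    (LinearMap.BilinForm.toMatrix (Module.finBasis (ZMod p) (image g)) (wallForm g)).det

theorem wallSign_eq [Fact p.Prime] [Finite V] (g : isometryGroup f) {ι : Type*} [Fintype ι]
    [DecidableEq ι] (b : Module.Basis ι (ZMod p) (image g)) :
    wallSign g =
      quadraticChar (ZMod p) (LinearMap.BilinForm.toMatrix b (wallForm g)).det := by
  classical
  let c := Module.finBasis (ZMod p) (image g)
  let e : ι ≃ Fin (Module.finrank (ZMod p) (image g)) := b.indexEquiv c
  let b' := b.reindex e
  have h1 : (LinearMap.BilinForm.toMatrix b' (wallForm g)).det =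
      (LinearMap.BilinForm.toMatrix b (wallForm g)).det := by
    rw [← Matrix.det_submatrix_equiv_self e.symm]
    congr 1
    ext i j
    simp [b', LinearMap.BilinForm.toMatrix_apply]
  have h2 := congrArg Matrix.det
    (LinearMap.BilinForm.toMatrix_mul_basis_toMatrix (b := c) b' (wallForm g))
  rw [Matrix.det_mul, Matrix.det_mul, Matrix.det_transpose, h1] at h2
  have h3 : (c.toMatrix b').det ≠ 0 := by
    have h := congrArg Matrix.det (c.toMatrix_mul_toMatrix_flip b')
    rw [Matrix.det_mul, Matrix.det_one] at h
    exact left_ne_zero_of_mul_eq_one h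
  rw [← h2, mul_right_comm, map_mul, ← pow_two, quadraticChar_sq_one' h3, one_mul]
  rfl

variable {K : Type*} [Field K]

/-- `exp t = ε ^ t` for `t ∈ F_p`. -/
def expo (ε : K) (t : ZMod p) : K := ε ^ t.val

/-- The quadratic Gauss sum `θ = ∑_{a ∈ F_p} exp (a ^ 2)`. -/
def gaussSum (p : ℕ) [Fact p.Prime] (ε : K) : K := ∑ a : ZMod p, expo ε (a ^ 2)

/-- `μ(g) = |I(g)|⁻¹ θ ^ i(g) δ_g`. -/
def splitting [Fact p.Prime] [Finite V] (ε : K) (g : isometryGroup f) : K :=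
  (Nat.card (image g) : K)⁻¹ * gaussSum p ε ^ imageDim g * (wallSign g : K)

/-- The form `γ_{g,h} = f_g - f_{h⁻¹}` on `I(g) ∩ I(h⁻¹)`, evaluated at `(u, v)`. -/
def gammaForm (g h : isometryGroup f) (u v : ↥(image g ⊓ image h⁻¹)) : ZMod p :=
  wallForm g ⟨u, u.2.1⟩ ⟨v, v.2.1⟩ - wallForm h⁻¹ ⟨u, u.2.2⟩ ⟨v, v.2.2⟩

/-- The factor set
`σ(g,h) = |I(g)|⁻¹ |I(h)|⁻¹ |I(gh)| ∑_{x ∈ I(g) ∩ I(h⁻¹)} exp (γ_{g,h}(x,x))`. -/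
def factorSet (ε : K) (g h : isometryGroup f) : K :=
  (Nat.card (image g) : K)⁻¹ * (Nat.card (image h) : K)⁻¹ * (Nat.card (image (g * h)) : K) *
    ∑ᶠ x : ↥(image g ⊓ image h⁻¹), expo ε (gammaForm g h x x)

variable {V' : Type*} [AddCommGroup V'] [Module K V']

/-- `s(g) = |V|⁻¹ ∑_{y ∈ V} ρ(y, 0) ρ(yg, 0)⁻¹`. -/
def weilOp [Fintype V] (ρ : Representation K (Extraspecial f) V') (g : isometryGroup f) :
    Module.End K V' :=
  (Fintype.card V : K)⁻¹ • ∑ y : V, ρ ⟨y, 0⟩ * ρ (⟨act g y, 0⟩ : Extraspecial f)⁻¹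

end

/-- The representation on `L ⊗ V'` obtained from `ρ` by extension of scalars. -/
noncomputable def extendScalars {K G V' : Type*} [Field K] [Group G] [AddCommGroup V']
    [Module K V'] (L : Type*) [Field L] [Algebra K L] (ρ : Representation K G V') :
    Representation L G (L ⊗[K] V') :=
  (Module.End.baseChangeHom K L V' : Module.End K V' →* Module.End L (L ⊗[K] V')).comp ρ

/-- `ρ` is absolutely irreducible: it stays irreducible over every extension field (it suffices
to let the extension run over one universe, as that contains an algebraic closure). -/
def IsAbsolutelyIrreducible {K : Type u} {G V' : Type*} [Field K] [Group G] [AddCommGroup V']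
    [Module K V'] (ρ : Representation K G V') : Prop :=
  ∀ (L : Type u) [Field L] [Algebra K L], (extendScalars L ρ).IsIrreducible

end Weil

/-! Write `w(B)` for `θ ^ dim` times the sign of the discriminant, so that `μ(g) = |I(g)|⁻¹ w(f_g)`.
The splitting amounts to `(∑ exp γ(x,x)) w(f_{gh}) = w(f_g) w(f_h)`. On `I(g) × I(h)` take the form
`B = f_g + f_h + f(a₁, b₂)` (`pairForm`). It is block triangular, so `w(B) = w(f_g) w(f_h)`. Its
antisymmetric part is `f(a₁ + a₂, b₁ + b₂)`, so `B` is symmetric against the antidiagonal `N`, a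
copy of `I(g) ∩ I(h⁻¹)` on which `B` is `γ`. Moreover `N^⊥` consists of the pairs `(u(1 - g), ug(1 -
h))`, and adding coordinates identifies `N^⊥/(N ∩ N^⊥)` with `I(gh)` carrying `f_{gh}`. The Gauss
sum over `N` is then `w(B)/w(f_{gh})` by `sum_mul_gaussWeight`, a Witt-style induction on `dim N`.

For the factor set, the `ρ(x,0)` are orthogonal for the trace form and number `dim End V'`, hence
form a basis; what commutes with all of them is scalar. Since `s(g)` intertwines `ρ` with its twist
by `g`, `s(g)s(h)s(gh)⁻¹` is a scalar, read off from traces. -/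

namespace Weil

/-! ### Quadratic Gauss sums over a finite field. -/

section Gauss

variable {F K : Type*} [Field F] [Fintype F] [DecidableEq F] [Field K]

/-- The sum `∑ ψ (a ^ 2)` attached to an additive character `ψ` of a finite field. -/
def sqSum (ψ : AddChar F K) : K := ∑ a : F, ψ (a ^ 2)

/-- Each `t` has `1 + χ(t)` square roots, and the constant `1` contributes a full character sum,
which vanishes. -/
theorem sum_mul_sq_eq_sum_quadraticChar (hF : ringChar F ≠ 2) {ψ : AddChar F K}
    (hψ : ψ.IsPrimitive) {c : F} (hc : c ≠ 0) :
    ∑ a : F, ψ (c * a ^ 2) = ∑ t : F, (quadraticChar F t : K) * ψ (c * t) := by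
  have h0 : ∑ t : F, ψ (c * t) = 0 := by
    have := AddChar.sum_mulShift (ψ := ψ) c hψ
    simpa [hc, mul_comm] using this
  have h1 : ∑ a : F, ψ (c * a ^ 2) = ∑ t : F, ((quadraticChar F t + 1 : ℤ) : K) * ψ (c * t) := by
    rw [← Finset.sum_fiberwise_of_maps_to (g := fun a : F => a ^ 2) (t := Finset.univ)
      (fun _ _ => Finset.mem_univ _)]
    refine Finset.sum_congr rfl fun t _ => ?_
    rw [← quadraticChar_card_sqrts hF t]
    have : ∀ a ∈ Finset.univ.filter (fun a : F => a ^ 2 = t), ψ (c * a ^ 2) = ψ (c * t) := by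
      intro a ha
      rw [(Finset.mem_filter.1 ha).2]
    rw [Finset.sum_congr rfl this, Finset.sum_const, nsmul_eq_mul]
    simp
  rw [h1]
  push_cast
  simp only [add_mul, one_mul, Finset.sum_add_distrib, h0, add_zero]

theorem quadraticChar_cast_mul_self {c : F} (hc : c ≠ 0) :
    (quadraticChar F c : K) * (quadraticChar F c : K) = 1 := by
  have := quadraticChar_sq_one hc
  rw [pow_two] at this
  exact_mod_cast congrArg (Int.cast : ℤ → K) this

theorem sum_mul_sq (hF : ringChar F ≠ 2) {ψ : AddChar F K} (hψ : ψ.IsPrimitive) {c : F}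
    (hc : c ≠ 0) : ∑ a : F, ψ (c * a ^ 2) = (quadraticChar F c : K) * sqSum ψ := by
  have h1 : sqSum ψ = ∑ t : F, (quadraticChar F t : K) * ψ t := by
    simpa [sqSum] using sum_mul_sq_eq_sum_quadraticChar hF hψ one_ne_zero
  rw [sum_mul_sq_eq_sum_quadraticChar hF hψ hc, h1, Finset.mul_sum]
  refine Fintype.sum_equiv (Equiv.mulLeft₀ c hc) _ _ fun t => ?_
  rw [Equiv.mulLeft₀_apply, map_mul (quadraticChar F), Int.cast_mul, ← mul_assoc, ← mul_assoc,
    quadraticChar_cast_mul_self hc, one_mul]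

/-- The left side is the Gauss sum of `a² - b²`. The shift `a ↦ a + b` turns this into `a² + 2ab`,
linear in `b`, so only `a = 0` survives. -/
theorem quadraticChar_neg_one_mul_sqSum_sq (hF : ringChar F ≠ 2) {ψ : AddChar F K}
    (hψ : ψ.IsPrimitive) : (quadraticChar F (-1) : K) * sqSum ψ ^ 2 = Fintype.card F := by
  have h2 : (2 : F) ≠ 0 := Ring.two_ne_zero hF
  have h := sum_mul_sq hF hψ (c := -1) (by simp)
  have h3 : ∀ b : F, ∑ a : F, ψ (a ^ 2) * ψ (-1 * b ^ 2) = ∑ a : F, ψ (a ^ 2 + a * (2 * b)) := by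
    intro b
    refine Fintype.sum_equiv (Equiv.subRight b) _ _ fun a => ?_
    rw [← AddChar.map_add_eq_mul]
    congr 1
    simp only [Equiv.subRight_apply]
    ring
  calc (quadraticChar F (-1) : K) * sqSum ψ ^ 2 = sqSum ψ * ∑ b : F, ψ (-1 * b ^ 2) := by
        rw [h]; ring
    _ = ∑ b : F, ∑ a : F, ψ (a ^ 2) * ψ (-1 * b ^ 2) := by
        rw [sqSum, Finset.sum_mul_sum, Finset.sum_comm]
    _ = ∑ a : F, ψ (a ^ 2) * ∑ b : F, ψ (b * (2 * a)) := by
        simp only [h3]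
        rw [Finset.sum_comm]
        refine Finset.sum_congr rfl fun a _ => ?_
        rw [Finset.mul_sum]
        refine Finset.sum_congr rfl fun b _ => ?_
        rw [AddChar.map_add_eq_mul]
        congr 2
        ring
    _ = Fintype.card F := by
        simp only [AddChar.sum_mulShift _ hψ, mul_eq_zero, h2, false_or]
        rw [Finset.sum_eq_single 0]
        · simp
        · intro a _ ha
          simp [ha]
        · simp

end Gauss

/-! ### Splitting forms and sums along a decomposition of the space. -/

section Splitting

variable {F : Type*} [Field F] {W H U : Type*} [AddCommGroup W] [Module F W]
  [AddCommGroup H] [Module F H] [AddCommGroup U] [Module F U]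

open LinearMap (BilinForm)

/-- The forms are not symmetric, so orthogonality is asked on one side only: a block triangular
matrix suffices. -/
theorem det_toMatrix_of_prod {ι κ : Type*} [Fintype ι] [Fintype κ] [DecidableEq ι] [DecidableEq κ]
    (b : Module.Basis ι F H) (c : Module.Basis κ F U) {B : BilinForm F W} (e : (H × U) ≃ₗ[F] W)
    {C : BilinForm F H} {D : BilinForm F U} (hC : ∀ x y, B (e (x, 0)) (e (y, 0)) = C x y)
    (hD : ∀ x y, B (e (0, x)) (e (0, y)) = D x y) (h0 : ∀ x y, B (e (0, x)) (e (y, 0)) = 0) :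
    (LinearMap.BilinForm.toMatrix ((b.prod c).map e) B).det =
      (LinearMap.BilinForm.toMatrix b C).det * (LinearMap.BilinForm.toMatrix c D).det := by
  rw [← Matrix.det_fromBlocks_zero₂₁ _ (Matrix.of fun i j => B (e (b i, 0)) (e (0, c j)))]
  congr 1
  ext (i | i) (j | j) <;> simp [LinearMap.BilinForm.toMatrix_apply, hC, hD, h0]

/-- A linear map with a section splits its domain. -/
noncomputable def sectionEquiv (φ : W →ₗ[F] H) (s : H →ₗ[F] W) (hs : ∀ a, φ (s a) = a) :
    (H × LinearMap.ker φ) ≃ₗ[F] W where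
  toFun q := s q.1 + q.2
  invFun w := (φ w, ⟨w - s (φ w), by simp [hs]⟩)
  map_add' a b := by simp; abel
  map_smul' a b := by simp
  left_inv q := by
    have h : φ q.2 = 0 := q.2.2
    ext <;> simp [hs, h]
  right_inv w := by simp

@[simp] theorem sectionEquiv_apply (φ : W →ₗ[F] H) (s : H →ₗ[F] W) (hs : ∀ a, φ (s a) = a)
    (q : H × LinearMap.ker φ) : sectionEquiv φ s hs q = s q.1 + q.2 := rfl

variable [FiniteDimensional F H] [FiniteDimensional F U]

theorem nondegenerate_of_prod {B : BilinForm F W} (hB : B.Nondegenerate) (e : (H × U) ≃ₗ[F] W)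
    {C : BilinForm F H} {D : BilinForm F U} (hC : ∀ x y, B (e (x, 0)) (e (y, 0)) = C x y)
    (hD : ∀ x y, B (e (0, x)) (e (0, y)) = D x y) (h0 : ∀ x y, B (e (0, x)) (e (y, 0)) = 0) :
    D.Nondegenerate := by
  let b := Module.finBasis F H
  let c := Module.finBasis F U
  rw [LinearMap.BilinForm.nondegenerate_iff_det_ne_zero ((b.prod c).map e),
    det_toMatrix_of_prod b c e hC hD h0] at hB
  exact (LinearMap.BilinForm.nondegenerate_iff_det_ne_zero c).2 (right_ne_zero_of_mul hB)

theorem nondegenerate_prod {B : BilinForm F W} (e : (H × U) ≃ₗ[F] W)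
    {C : BilinForm F H} {D : BilinForm F U} (hC : ∀ x y, B (e (x, 0)) (e (y, 0)) = C x y)
    (hD : ∀ x y, B (e (0, x)) (e (0, y)) = D x y) (h0 : ∀ x y, B (e (0, x)) (e (y, 0)) = 0)
    (hCn : C.Nondegenerate) (hDn : D.Nondegenerate) : B.Nondegenerate := by
  let b := Module.finBasis F H
  let c := Module.finBasis F U
  rw [LinearMap.BilinForm.nondegenerate_iff_det_ne_zero ((b.prod c).map e),
    det_toMatrix_of_prod b c e hC hD h0]
  exact mul_ne_zero ((LinearMap.BilinForm.nondegenerate_iff_det_ne_zero b).1 hCn)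
    ((LinearMap.BilinForm.nondegenerate_iff_det_ne_zero c).1 hDn)

theorem sum_ker_mul {K : Type*} [Field K] [Fintype F] {X : Type*} [AddCommGroup X] [Module F X]
    [Fintype X] (φ : X →ₗ[F] F) (x₀ : X) (h : φ x₀ = 1) [Fintype (LinearMap.ker φ)] (q : X → K) (r : F → K)
    (hq : ∀ (a : F) (x : LinearMap.ker φ), q (a • x₀ + x) = r a * q x) :
    ∑ x, q x = (∑ a, r a) * ∑ x : LinearMap.ker φ, q x := by
  let e := sectionEquiv φ (LinearMap.toSpanSingleton F X x₀) (by intro a; simp [h])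
  rw [Finset.sum_mul_sum, ← Fintype.sum_prod_type']
  refine (Fintype.sum_equiv e.toEquiv _ _ fun y => ?_).symm
  simp [e, hq]

end Splitting

/-! ### The Gauss weight of a form and its behaviour under reduction by a subspace. -/

section Weight

variable {F K : Type*} [Field F] [Fintype F] [DecidableEq F] [Field K]
variable {W : Type*} [AddCommGroup W] [Module F W] [FiniteDimensional F W]

open LinearMap (BilinForm)

/-- The quadratic character of the determinant of a bilinear form. -/
noncomputable def discSign (B : BilinForm F W) : ℤ :=
  quadraticChar F (LinearMap.BilinForm.toMatrix (Module.finBasis F W) B).det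

/-- A change of basis multiplies the determinant by a nonzero square. -/
theorem discSign_eq (B : BilinForm F W) {ι : Type*} [Fintype ι] [DecidableEq ι]
    (b : Module.Basis ι F W) : discSign B = quadraticChar F (LinearMap.BilinForm.toMatrix b B).det := by
  classical
  let c := Module.finBasis F W
  let e : ι ≃ Fin (Module.finrank F W) := b.indexEquiv c
  let b' := b.reindex e
  have h1 : (LinearMap.BilinForm.toMatrix b' B).det = (LinearMap.BilinForm.toMatrix b B).det := by
    rw [← Matrix.det_submatrix_equiv_self e.symm]
    congr 1
    ext i j
    simp [b', LinearMap.BilinForm.toMatrix_apply]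
  have h2 := congrArg Matrix.det (LinearMap.BilinForm.toMatrix_mul_basis_toMatrix (b := c) b' B)
  rw [Matrix.det_mul, Matrix.det_mul, Matrix.det_transpose, h1] at h2
  have h3 : (c.toMatrix b').det ≠ 0 := by
    have h := congrArg Matrix.det (c.toMatrix_mul_toMatrix_flip b')
    rw [Matrix.det_mul, Matrix.det_one] at h
    exact left_ne_zero_of_mul_eq_one h
  rw [← h2, mul_right_comm, map_mul, ← pow_two, quadraticChar_sq_one' h3, one_mul]
  rfl

/-- `θ ^ dim W` times the sign of the discriminant of `B`. -/
noncomputable def gaussWeight (ψ : AddChar F K) (B : BilinForm F W) : K :=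
  sqSum ψ ^ Module.finrank F W * (discSign B : K)

theorem gaussWeight_eq (ψ : AddChar F K) (B : BilinForm F W) {ι : Type*} [Fintype ι]
    [DecidableEq ι] (b : Module.Basis ι F W) :
    gaussWeight ψ B =
      sqSum ψ ^ Fintype.card ι * (quadraticChar F (LinearMap.BilinForm.toMatrix b B).det : K) := by
  rw [gaussWeight, discSign_eq B b, Module.finrank_eq_card_basis b]

theorem gaussWeight_ne_zero (hF : ringChar F ≠ 2) {ψ : AddChar F K} (hψ : ψ.IsPrimitive)
    (hK : (Fintype.card F : K) ≠ 0) {B : BilinForm F W} (hB : B.Nondegenerate) :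
    gaussWeight ψ B ≠ 0 := by
  rw [gaussWeight_eq ψ B (Module.finBasis F W)]
  have h := quadraticChar_neg_one_mul_sqSum_sq hF hψ
  refine mul_ne_zero (pow_ne_zero _ fun h0 => hK ?_) (left_ne_zero_of_mul_eq_one
    (quadraticChar_cast_mul_self ?_))
  · rw [← h, h0]; simp
  · exact (LinearMap.BilinForm.nondegenerate_iff_det_ne_zero _).1 hB

section Equiv

variable {H U : Type*} [AddCommGroup H] [Module F H] [AddCommGroup U] [Module F U]

variable [FiniteDimensional F H] [FiniteDimensional F U]

theorem gaussWeight_of_prod (ψ : AddChar F K) {B : BilinForm F W} (e : (H × U) ≃ₗ[F] W)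
    {C : BilinForm F H} {D : BilinForm F U} (hC : ∀ x y, B (e (x, 0)) (e (y, 0)) = C x y)
    (hD : ∀ x y, B (e (0, x)) (e (0, y)) = D x y) (h0 : ∀ x y, B (e (0, x)) (e (y, 0)) = 0) :
    gaussWeight ψ B = gaussWeight ψ C * gaussWeight ψ D := by
  let b := Module.finBasis F H
  let c := Module.finBasis F U
  rw [gaussWeight_eq ψ B ((b.prod c).map e), gaussWeight_eq ψ C b, gaussWeight_eq ψ D c,
    det_toMatrix_of_prod b c e hC hD h0]
  simp only [Fintype.card_sum, pow_add, map_mul, Int.cast_mul]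
  ring

theorem gaussWeight_of_equiv (ψ : AddChar F K) {B : BilinForm F W} {D : BilinForm F U}
    (e : W ≃ₗ[F] U) (he : ∀ x y, D (e x) (e y) = B x y) : gaussWeight ψ B = gaussWeight ψ D := by
  let b := Module.finBasis F W
  rw [gaussWeight_eq ψ B b, gaussWeight_eq ψ D (b.map e)]
  congr 4
  ext i j
  simp [LinearMap.BilinForm.toMatrix_apply, he]

end Equiv

/-- Splitting off an anisotropic line. -/
theorem gaussWeight_of_anisotropic (ψ : AddChar F K) {B : BilinForm F W} (hB : B.Nondegenerate)
    {n : W} (hn : B n n ≠ 0) {U : Submodule F W} (hU : ∀ w, w ∈ U ↔ B w n = 0) :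
    (B.restrict U).Nondegenerate ∧
      gaussWeight ψ B = (quadraticChar F (B n n) : K) * sqSum ψ * gaussWeight ψ (B.restrict U) := by
  let φ : W →ₗ[F] F := (B n n)⁻¹ • B.flip n
  obtain rfl : U = LinearMap.ker φ := by
    ext w
    simp [hU, φ, hn]
  let C : BilinForm F F := (LinearMap.mul F F).compr₂ (LinearMap.lsmul F F (B n n))
  let e := sectionEquiv φ (LinearMap.toSpanSingleton F W n) (by intro a; simp [φ, hn])
  have hC : ∀ x y, B (e (x, 0)) (e (y, 0)) = C x y := by
    intro x y; simp [e, C]; ring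
  have hD : ∀ x y, B (e (0, x)) (e (0, y)) = B.restrict (LinearMap.ker φ) x y := by
    intro x y; simp [e]
  have h0 : ∀ x y, B (e (0, x)) (e (y, 0)) = 0 := by
    intro x y
    have := (hU x).1 x.2
    simp [e, this]
  refine ⟨nondegenerate_of_prod hB e hC hD h0, ?_⟩
  rw [gaussWeight_of_prod ψ e hC hD h0, gaussWeight_eq ψ C (Module.Basis.singleton Unit F)]
  simp [LinearMap.BilinForm.toMatrix_apply, C, mul_comm]

/-- Splitting off a hyperbolic plane. -/
theorem gaussWeight_of_isotropic (ψ : AddChar F K) {B : BilinForm F W} (hB : B.Nondegenerate)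
    {n m : W} (hn : B n n = 0) (hnm : B n m = 1) (hmn : B m n = 1) {U : Submodule F W}
    (hU : ∀ w, w ∈ U ↔ B w n = 0 ∧ B w m = 0) :
    (B.restrict U).Nondegenerate ∧
      gaussWeight ψ B =
        (quadraticChar F (-1) : K) * sqSum ψ ^ 2 * gaussWeight ψ (B.restrict U) := by
  -- Corrected by `B m m` so that `n ↦ (1, 0)` and `m ↦ (0, 1)`.
  let φ : W →ₗ[F] F × F := (B.flip m - B m m • B.flip n).prod (B.flip n)
  obtain rfl : U = LinearMap.ker φ := by
    ext w
    have : φ w = (B w m - B m m * B w n, B w n) := rfl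
    rw [hU, LinearMap.mem_ker, this, Prod.mk_eq_zero]
    constructor
    · rintro ⟨h1, h2⟩
      simp [h1, h2]
    · rintro ⟨h1, h2⟩
      simpa [h2] using h1
  let s : F × F →ₗ[F] W :=
    (LinearMap.toSpanSingleton F W n).coprod (LinearMap.toSpanSingleton F W m)
  let C : BilinForm F (F × F) := B.compl₁₂ s s
  let e := sectionEquiv φ s (by
    rintro ⟨a, b⟩
    simp [φ, s, hn, hnm, hmn, mul_comm])
  have hC : ∀ x y, B (e (x, 0)) (e (y, 0)) = C x y := by
    intro x y; simp [e, C]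
  have hD : ∀ x y, B (e (0, x)) (e (0, y)) = B.restrict (LinearMap.ker φ) x y := by
    intro x y; simp [e]
  have h0 : ∀ x y, B (e (0, x)) (e (y, 0)) = 0 := by
    intro x y
    obtain ⟨h1, h2⟩ := (hU x).1 x.2
    simp [e, s, h1, h2]
  refine ⟨nondegenerate_of_prod hB e hC hD h0, ?_⟩
  rw [gaussWeight_of_prod ψ e hC hD h0, gaussWeight_eq ψ C (Module.Basis.finTwoProd F)]
  -- The Gram matrix of `n, m` has determinant `-1` whatever `B m m` is.
  rw [Matrix.det_fin_two]
  simp [LinearMap.BilinForm.toMatrix_apply, C, s, hn, hnm, hmn, mul_comm]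

/-- Let `N` be a subspace, embedded by `ν`, on which a nondegenerate form `B` is symmetric against
everything. If `N^⊥` modulo its intersection with `N` is identified with `P`, carrying the form `G`
induced by `B`, then the Gauss sum of `B` over `N` is the quotient of the weights of `B`
and `G`. -/
theorem sum_mul_gaussWeight (hF : ringChar F ≠ 2) {ψ : AddChar F K} (hψ : ψ.IsPrimitive)
    {X Y P : Type*} [AddCommGroup X] [Module F X] [Fintype X] [AddCommGroup Y] [Module F Y]
    [AddCommGroup P] [Module F P] [FiniteDimensional F P]
    {B : BilinForm F W} (hB : B.Nondegenerate)
    (ν : X →ₗ[F] W) (hν : Function.Injective ν) (hsymm : ∀ x w, B w (ν x) = B (ν x) w)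
    (l : Y →ₗ[F] W) (hl : ∀ w, w ∈ LinearMap.range l ↔ ∀ x, B w (ν x) = 0)
    (π : Y →ₗ[F] P) (hπ : Function.Surjective π)
    (hker : ∀ y, π y = 0 ↔ l y ∈ LinearMap.range ν)
    (G : BilinForm F P) (hG : ∀ y y', G (π y) (π y') = B (l y) (l y')) :
    (∑ x : X, ψ (B (ν x) (ν x))) * gaussWeight ψ G = gaussWeight ψ B := by
  obtain ⟨k, hk⟩ : ∃ k, Module.finrank F X = k := ⟨_, rfl⟩
  have : FiniteDimensional F X := Module.Finite.of_finite
  induction k generalizing X W with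
  | zero =>
    have : Subsingleton X := Module.finrank_zero_iff.1 hk
    have hl' : Function.Surjective l := fun w => (hl w).2 fun x => by
      simp [Subsingleton.elim x 0]
    have hk' : LinearMap.ker l = LinearMap.ker π := by
      ext y
      rw [LinearMap.mem_ker, LinearMap.mem_ker, hker]
      constructor
      · intro h; exact ⟨0, by simp [h]⟩
      · rintro ⟨x, hx⟩; rw [← hx, Subsingleton.elim x 0, map_zero]
    -- With `N = 0`, both `W` and `P` are the quotient of `Y` by the same kernel.
    let e : W ≃ₗ[F] P := (l.quotKerEquivOfSurjective hl').symm ≪≫ₗ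
      Submodule.quotEquivOfEq _ _ hk' ≪≫ₗ π.quotKerEquivOfSurjective hπ
    have he : ∀ y, e (l y) = π y := by
      intro y
      have : (l.quotKerEquivOfSurjective hl').symm (l y) = Submodule.Quotient.mk y := by
        rw [LinearEquiv.symm_apply_eq]; rfl
      simp only [e, LinearEquiv.trans_apply, this]
      rfl
    rw [gaussWeight_of_equiv ψ (D := G) e]
    · rw [Fintype.sum_subsingleton _ (0 : X)]
      simp
    · intro x y
      obtain ⟨x, rfl⟩ := hl' x
      obtain ⟨y, rfl⟩ := hl' y
      rw [he, he, hG]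
  | succ k ih =>
    have hdim : ∀ (φ : X →ₗ[F] F) (x₀ : X), φ x₀ = 1 →
        Module.finrank F (LinearMap.ker φ) = k := by
      intro φ x₀ h
      have h1 := LinearMap.finrank_range_add_finrank_ker φ
      have h2 : LinearMap.range φ = ⊤ := LinearMap.range_eq_top.2 fun a =>
        ⟨a • x₀, by simp [h]⟩
      rw [h2, finrank_top, Module.finrank_self] at h1
      omega
    -- An anisotropic vector of `N` is split off: the sum and the weight of `B` both lose the factor
    -- `χ(c) θ`, while `N^⊥` already lies in `U`.
    by_cases hiso : ∃ x, B (ν x) (ν x) ≠ 0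
    · obtain ⟨x₀, hx₀⟩ := hiso
      set c := B (ν x₀) (ν x₀) with hc
      let U : Submodule F W := LinearMap.ker (B.flip (ν x₀))
      have hU : ∀ w, w ∈ U ↔ B w (ν x₀) = 0 := fun w => by simp [U]
      let φ : X →ₗ[F] F := c⁻¹ • (B.flip (ν x₀)).comp ν
      have hφ : φ x₀ = 1 := by simp [φ, ← hc, hx₀]
      have hφU : ∀ x : LinearMap.ker φ, B (ν x) (ν x₀) = 0 := fun x =>
        (mul_eq_zero.1 (show c⁻¹ * B (ν x) (ν x₀) = 0 from x.2)).resolve_left (inv_ne_zero hx₀)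
      have hφU' : ∀ x : LinearMap.ker φ, ν x ∈ U := fun x => (hU _).2 (hφU x)
      have hlU : ∀ y, l y ∈ U := fun y => (hU _).2 ((hl _).1 ⟨y, rfl⟩ x₀)
      obtain ⟨hB', hw⟩ := gaussWeight_of_anisotropic ψ hB hx₀ hU
      have := Fintype.ofFinite (LinearMap.ker φ)
      have key := ih (W := U) (X := LinearMap.ker φ) hB'
        ((ν.comp (LinearMap.ker φ).subtype).codRestrict U hφU')
        (fun x y h => Subtype.ext (hν (congrArg Subtype.val h)))
        (fun x w => hsymm x w) (l.codRestrict U hlU)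
        (by
          rintro ⟨w, hw⟩
          constructor
          · rintro ⟨y, hy⟩ x
            exact (hl w).1 ⟨y, congrArg Subtype.val hy⟩ x
          · intro h
            obtain ⟨y, hy⟩ := (hl w).2 fun x => by
              have h1 := h ⟨x - φ x • x₀, by simp [hφ]⟩
              have h2 := (hU w).1 hw
              change B w (ν (x - φ x • x₀)) = 0 at h1
              simpa [h2] using h1
            exact ⟨y, Subtype.ext hy⟩)
        (by
          intro y
          rw [hker]
          constructor
          · rintro ⟨x, hx⟩
            refine ⟨⟨x, ?_⟩, Subtype.ext hx⟩
            have := (hU _).1 (hlU y)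
            rw [← hx] at this
            simp [φ, this]
          · rintro ⟨x, hx⟩
            exact ⟨x, congrArg Subtype.val hx⟩)
        (fun y y' => hG y y') (hdim φ x₀ hφ) inferInstance
      rw [hw, ← key, ← sum_mul_sq hF hψ hx₀, sum_ker_mul φ x₀ hφ _ (fun a => ψ (c * a ^ 2))]
      · rw [mul_assoc]
        rfl
      · intro a x
        rw [← AddChar.map_add_eq_mul]
        congr 1
        have h1 := hφU x
        have h2 := hsymm x₀ (ν x)
        rw [h1] at h2
        simp [← hc, h1, ← h2]
        ring
    · push Not at hiso
      have h2 : (2 : F) ≠ 0 := Ring.two_ne_zero hF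
      -- Polarization, using symmetry on `N` and odd characteristic: `N` is totally isotropic.
      have hz : ∀ x y, B (ν x) (ν y) = 0 := by
        intro x y
        have h := hiso (x + y)
        simp only [map_add, LinearMap.add_apply, hiso, zero_add, add_zero, hsymm x (ν y)] at h
        rw [← two_mul] at h
        exact (mul_eq_zero.1 h).resolve_left h2
      have : Nontrivial X := Module.nontrivial_of_finrank_pos (R := F) (by omega)
      obtain ⟨x₀, hx₀⟩ := exists_ne (0 : X)
      obtain ⟨m, hm⟩ : ∃ m, B m (ν x₀) = 1 := by
        by_contra! hcon
        refine hx₀ (hν ?_)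
        rw [map_zero]
        refine hB.2 _ fun w => ?_
        by_contra hne
        exact hcon ((B w (ν x₀))⁻¹ • w) (by simp [hne])
      have hm' : B (ν x₀) m = 1 := by rw [← hsymm, hm]
      let U : Submodule F W := LinearMap.ker (B.flip (ν x₀)) ⊓ LinearMap.ker (B.flip m)
      have hU : ∀ w, w ∈ U ↔ B w (ν x₀) = 0 ∧ B w m = 0 := fun w => by simp [U]
      let φ : X →ₗ[F] F := (B.flip m).comp ν
      have hφ : φ x₀ = 1 := hm'
      have hφU' : ∀ x : LinearMap.ker φ, ν x ∈ U := fun x => (hU _).2 ⟨hz _ _, x.2⟩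
      -- `N^⊥` need not be orthogonal to `m`. Subtracting a multiple of `ν x₀` moves it into `U` and
      -- changes neither classes modulo `N` nor values of `B` on `N^⊥`.
      let l' : Y →ₗ[F] W := l - (LinearMap.toSpanSingleton F W (ν x₀)).comp ((B.flip m).comp l)
      have hl'a : ∀ y, l' y = l y - B (l y) m • ν x₀ := fun y => by simp [l']
      have hly : ∀ y x, B (l y) (ν x) = 0 := fun y => (hl _).1 ⟨y, rfl⟩
      have hlU : ∀ y, l' y ∈ U := fun y => (hU _).2 (by
        simp [hl'a, hly, hz, hm'])
      obtain ⟨hB', hw⟩ := gaussWeight_of_isotropic ψ hB (hz x₀ x₀) hm' hm hU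
      have := Fintype.ofFinite (LinearMap.ker φ)
      have key := ih (W := U) (X := LinearMap.ker φ) hB'
        ((ν.comp (LinearMap.ker φ).subtype).codRestrict U hφU')
        (fun x y h => Subtype.ext (hν (congrArg Subtype.val h)))
        (fun x w => hsymm x w) (l'.codRestrict U hlU)
        (by
          rintro ⟨w, hw⟩
          constructor
          · rintro ⟨y, hy⟩ x
            have hy' : l' y = w := congrArg Subtype.val hy
            change B w (ν x) = 0
            rw [← hy', hl'a]
            simp [hly, hz]
          · intro h
            obtain ⟨h3, h4⟩ := (hU w).1 hw
            obtain ⟨y, hy⟩ := (hl w).2 fun x => by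
              have h1 := h ⟨x - φ x • x₀, by simp [hφ]⟩
              change B w (ν (x - φ x • x₀)) = 0 at h1
              simpa [h3] using h1
            refine ⟨y, Subtype.ext ?_⟩
            change l' y = w
            rw [hl'a, hy, h4, zero_smul, sub_zero])
        (by
          intro y
          rw [hker]
          constructor
          · rintro ⟨x, hx⟩
            refine ⟨⟨x - B (l y) m • x₀, ?_⟩, Subtype.ext ?_⟩
            · have : φ x = B (l y) m := by rw [← hx]; rfl
              simp [hφ, this]
            · change ν (x - B (l y) m • x₀) = l' y
              rw [hl'a, map_sub, hx, map_smul]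
          · rintro ⟨x, hx⟩
            have hx' : ν x = l' y := congrArg Subtype.val hx
            refine ⟨x + B (l y) m • x₀, ?_⟩
            rw [map_add, hx', map_smul, hl'a, sub_add_cancel])
        (fun y y' => by
          change _ = B (l' y) (l' y')
          rw [hG, hl'a, hl'a]
          simp [hly, hz, ← hsymm]) (hdim φ x₀ hφ) inferInstance
      -- The isotropic line contributes `|F|` to the sum, which is exactly the weight of the
      -- hyperbolic plane.
      rw [hw, ← key, quadraticChar_neg_one_mul_sqSum_sq hF hψ,
        sum_ker_mul φ x₀ hφ _ (fun _ => 1)]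
      · rw [mul_assoc, Finset.sum_const, Finset.card_univ, nsmul_eq_mul, mul_one]
        rfl
      · intro a x
        rw [hz, hz, one_mul]

end Weight

/-! ### The character `exp` of `F_p`. -/

section Expo

variable {p : ℕ} [Fact p.Prime]

theorem ringChar_zmod_ne_two (hp : Odd p) : ringChar (ZMod p) ≠ 2 := by
  rw [ZMod.ringChar_zmod_n]
  rintro rfl
  exact absurd hp (by decide)

variable {K : Type*} [Field K] {ε : K}

theorem zmodChar_eq_expo (h : ε ^ p = 1) (t : ZMod p) : AddChar.zmodChar p h t = expo ε t :=
  AddChar.zmodChar_apply h t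

theorem expo_zero : expo ε (0 : ZMod p) = 1 := by simp [expo]

theorem expo_add (h : ε ^ p = 1) (s t : ZMod p) : expo ε (s + t) = expo ε s * expo ε t := by
  simp only [← zmodChar_eq_expo h, AddChar.map_add_eq_mul]

theorem expo_injective (hε : IsPrimitiveRoot ε p) {s t : ZMod p} (h : expo ε s = expo ε t) :
    s = t :=
  ZMod.val_injective p (hε.pow_inj (ZMod.val_lt s) (ZMod.val_lt t) h)

theorem natCast_prime_ne_zero (hε : IsPrimitiveRoot ε p) : (p : K) ≠ 0 := by
  have : NeZero p := ⟨(Fact.out : p.Prime).ne_zero⟩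
  exact hε.neZero'.out

end Expo

/-! ### Wall forms: inversion, nondegeneracy and fixed spaces. -/

section Isometry

variable {p : ℕ} {V : Type*} [AddCommGroup V] [Module (ZMod p) V]
  {f : LinearMap.BilinForm (ZMod p) V}

@[simp] theorem act_one (x : V) : act (1 : isometryGroup f) x = x := rfl

@[simp] theorem act_inv_act (g : isometryGroup f) (x : V) : act g⁻¹ (act g x) = x := by
  rw [← act_mul, mul_inv_cancel, act_one]

@[simp] theorem act_act_inv (g : isometryGroup f) (x : V) : act g (act g⁻¹ x) = x := by
  rw [← act_mul, inv_mul_cancel, act_one]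

theorem image_inv (g : isometryGroup f) : image g⁻¹ = image g := by
  ext x
  constructor
  · rintro ⟨u, rfl⟩
    exact ⟨-act g⁻¹ u, by simp [sub_eq_add_neg, add_comm]⟩
  · rintro ⟨u, rfl⟩
    exact ⟨-act g u, by simp [sub_eq_add_neg, add_comm]⟩

theorem alt_neg (hf : f.IsAlt) (x y : V) : f x y = -f y x := (LinearMap.IsAlt.neg hf y x).symm

/-- The antisymmetric part of `f_g` is `f`. -/
theorem wallForm_sub_swap (hf : f.IsAlt) (g : isometryGroup f) (x y : image g) :
    wallForm g x y - wallForm g y x = f x y := by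
  obtain ⟨_, u, rfl⟩ := x
  obtain ⟨_, v, rfl⟩ := y
  rw [wallForm_apply g u _ _ rfl, wallForm_apply g v _ _ rfl]
  simp only [LinearMap.sub_apply, LinearMap.id_apply, map_sub, act_preserves]
  rw [alt_neg hf v u, alt_neg hf v (act g u)]
  ring

/-- If `x = u(1 - g)` then also `x = (-ug)(1 - g⁻¹)`; the antisymmetric part `f` of `f_g` does the
rest. -/
theorem wallForm_inv (hf : f.IsAlt) (g : isometryGroup f) {x y : V} (hx : x ∈ image g)
    (hy : y ∈ image g) (hx' : x ∈ image g⁻¹) (hy' : y ∈ image g⁻¹) :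
    wallForm g⁻¹ ⟨x, hx'⟩ ⟨y, hy'⟩ = -wallForm g ⟨y, hy⟩ ⟨x, hx⟩ := by
  have h := wallForm_sub_swap hf g ⟨x, hx⟩ ⟨y, hy⟩
  obtain ⟨u, rfl⟩ := id hx
  rw [wallForm_apply g u ⟨_, hx⟩ _ rfl] at h
  rw [wallForm_apply g⁻¹ (-act g u) _ _ (by simp [sub_eq_add_neg, add_comm])]
  simp only [LinearMap.sub_apply, LinearMap.id_apply, map_sub, map_neg, LinearMap.neg_apply]
    at h ⊢
  linear_combination -h

/-- The fixed space of `g` is the orthogonal of `I(g)`. -/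
theorem act_eq_self_iff (hf : f.Nondegenerate) (g : isometryGroup f) (u : V) :
    act g u = u ↔ ∀ x ∈ image g, f u x = 0 := by
  constructor
  · rintro h _ ⟨v, rfl⟩
    have := act_preserves g u v
    rw [h] at this
    simp [this]
  · intro h
    have h1 : act g u - u = 0 := by
      refine hf.1 _ fun w => ?_
      have h2 := h _ ⟨act g⁻¹ w, rfl⟩
      have h3 := act_preserves g u (act g⁻¹ w)
      simp only [LinearMap.sub_apply, LinearMap.id_apply, act_act_inv, map_sub] at h2 h3 ⊢
      rw [h3]
      exact h2
    exact sub_eq_zero.1 h1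

/-- If `u(1 - g)` is in the left radical, then `u ⟂ I(g)`, so `g` fixes `u` and `u(1 - g) = 0`. -/
theorem wallForm_nondegenerate [Fact p.Prime] [Finite V] (hf : f.Nondegenerate)
    (g : isometryGroup f) : (wallForm g).Nondegenerate := by
  have h : (wallForm g).SeparatingLeft := by
    rintro ⟨_, u, rfl⟩ h
    have h1 : act g u = u := (act_eq_self_iff hf g u).2 fun x hx => by
      rw [← h ⟨x, hx⟩, wallForm_apply g u _ ⟨x, hx⟩ rfl]
    ext
    simp [h1]
  exact LinearMap.BilinForm.Nondegenerate.ofSeparatingLeft h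

/-- Orthogonality to `I(g) ∩ I(h)` means being a sum of fixed vectors of `g` and `h`. -/
theorem exists_add_of_orthogonal [Fact p.Prime] [Finite V] (hf : f.Nondegenerate) (hfa : f.IsAlt)
    (g h : isometryGroup f) (u : V) (hu : ∀ x ∈ image g ⊓ image h, f u x = 0) :
    ∃ a b, act g a = a ∧ act h b = b ∧ u = a + b := by
  have hk : ∀ (k : isometryGroup f) a, a ∈ f.orthogonal (image k) ↔ act k a = a := by
    intro k a
    rw [act_eq_self_iff hf, LinearMap.BilinForm.mem_orthogonal_iff]
    exact forall₂_congr fun x _ => hfa.isRefl.eq_iff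
  have h1 : f.orthogonal (f.orthogonal (image g) ⊔ f.orthogonal (image h)) ≤
      image g ⊓ image h := by
    refine le_inf ?_ ?_
    · rw [← LinearMap.BilinForm.orthogonal_orthogonal hf hfa.isRefl (image g)]
      exact LinearMap.BilinForm.orthogonal_le
        (by rw [LinearMap.BilinForm.orthogonal_orthogonal hf hfa.isRefl]; exact le_sup_left)
    · rw [← LinearMap.BilinForm.orthogonal_orthogonal hf hfa.isRefl (image h)]
      exact LinearMap.BilinForm.orthogonal_le
        (by rw [LinearMap.BilinForm.orthogonal_orthogonal hf hfa.isRefl]; exact le_sup_right)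
  have h2 : u ∈ f.orthogonal (image g) ⊔ f.orthogonal (image h) := by
    rw [← LinearMap.BilinForm.orthogonal_orthogonal hf hfa.isRefl (_ ⊔ _)]
    exact fun x hx => hfa.isRefl _ _ (hu x (h1 hx))
  obtain ⟨a, ha, b, hb, rfl⟩ := Submodule.mem_sup.1 h2
  exact ⟨a, b, (hk g a).1 ha, (hk h b).1 hb, rfl⟩

end Isometry

/-! ### The operators `ρ(x,0)`, their traces, and the expansion of `s(g)`. -/

section Operators

variable {p : ℕ} [Fact p.Prime] {V : Type*} [AddCommGroup V] [Module (ZMod p) V]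
  {f : LinearMap.BilinForm (ZMod p) V}
  {K V' : Type*} [Field K] [AddCommGroup V'] [Module K V']
  {ρ : Representation K (Extraspecial f) V'} {ε : K}

theorem rho_eq_smul (hρε : ∀ z : ZMod p, ρ ⟨0, z⟩ = expo ε z • (1 : Module.End K V'))
    (x : V) (z : ZMod p) : ρ ⟨x, z⟩ = expo ε z • ρ ⟨x, 0⟩ := by
  have : (⟨x, z⟩ : Extraspecial f) = ⟨0, z⟩ * ⟨x, 0⟩ := by ext <;> simp
  rw [this, map_mul, hρε, smul_mul_assoc, one_mul]

theorem rho_mul_rho (hρε : ∀ z : ZMod p, ρ ⟨0, z⟩ = expo ε z • (1 : Module.End K V'))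
    (x y : V) : ρ ⟨x, 0⟩ * ρ ⟨y, 0⟩ = expo ε (f x y) • ρ ⟨x + y, 0⟩ := by
  rw [← rho_eq_smul hρε, ← map_mul]
  congr 1
  ext <;> simp

theorem rho_zero : ρ ⟨0, 0⟩ = 1 := map_one ρ

/-- The two products of `ρ(y,0)` and `ρ(v-y,0)` have equal trace but are the multiples
`exp(±f(y,v))` of `ρ(v,0)`; choose `y` with `f(y,v) ≠ 0`. -/
theorem trace_rho (hp : Odd p) (hf : f.Nondegenerate) (hfa : f.IsAlt)
    (hε : IsPrimitiveRoot ε p)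
    (hρε : ∀ z : ZMod p, ρ ⟨0, z⟩ = expo ε z • (1 : Module.End K V')) {v : V} (hv : v ≠ 0) :
    LinearMap.trace K V' (ρ ⟨v, 0⟩) = 0 := by
  obtain ⟨y, hy⟩ : ∃ y, f y v ≠ 0 := by
    by_contra! h
    exact hv (hf.2 v h)
  have h := LinearMap.trace_mul_comm K (ρ ⟨y, 0⟩) (ρ ⟨v - y, 0⟩)
  rw [rho_mul_rho hρε, rho_mul_rho hρε, add_sub_cancel, sub_add_cancel, map_smul, map_smul,
    smul_eq_mul, smul_eq_mul] at h
  by_contra h0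
  have h1 := expo_injective hε (mul_right_cancel₀ h0 h)
  rw [alt_neg hfa (v - y) y, map_sub, hfa.self_eq_zero, sub_zero, eq_neg_iff_add_eq_zero,
    ← two_mul] at h1
  have h2 : (2 : ZMod p) ≠ 0 := Ring.two_ne_zero (ringChar_zmod_ne_two hp)
  exact hy ((mul_eq_zero.1 h1).resolve_left h2)

theorem trace_rho_mul_rho [FiniteDimensional K V'] [DecidableEq V]
    (hp : Odd p) (hf : f.Nondegenerate) (hfa : f.IsAlt)
    (hε : IsPrimitiveRoot ε p)
    (hρε : ∀ z : ZMod p, ρ ⟨0, z⟩ = expo ε z • (1 : Module.End K V')) (x y : V) :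
    LinearMap.trace K V' (ρ ⟨x, 0⟩ * ρ ⟨y, 0⟩) =
      if y = -x then (Module.finrank K V' : K) else 0 := by
  rw [rho_mul_rho hρε, map_smul]
  split_ifs with h
  · subst h
    rw [add_neg_cancel, rho_zero, map_neg, hfa.self_eq_zero, neg_zero, expo_zero, one_smul,
      LinearMap.trace_one]
  · rw [trace_rho hp hf hfa hε hρε, smul_zero]
    intro h0
    exact h (eq_neg_of_add_eq_zero_right h0)

/-- Trace orthogonality makes the `ρ(x,0)` independent, and by `hdim` they span `End V'`, so `A` is
central. -/
theorem exists_eq_smul_of_commute [FiniteDimensional K V'] [Fintype V]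
    (hp : Odd p) (hf : f.Nondegenerate)
    (hfa : f.IsAlt) (hε : IsPrimitiveRoot ε p)
    (hρε : ∀ z : ZMod p, ρ ⟨0, z⟩ = expo ε z • (1 : Module.End K V'))
    (hK : (Module.finrank K V' : K) ≠ 0)
    (hdim : Fintype.card V = Module.finrank K V' * Module.finrank K V') {A : Module.End K V'}
    (hA : ∀ x, ρ ⟨x, 0⟩ * A = A * ρ ⟨x, 0⟩) : ∃ c : K, A = c • 1 := by
  classical
  have hli : LinearIndependent K fun x : V => ρ (⟨x, 0⟩ : Extraspecial f) := by
    rw [Fintype.linearIndependent_iff]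
    intro c hc y
    have h := congrArg (fun T => LinearMap.trace K V' (T * ρ ⟨-y, 0⟩)) hc
    simp only [Finset.sum_mul, map_sum, smul_mul_assoc, map_smul,
      trace_rho_mul_rho hp hf hfa hε hρε, zero_mul, map_zero, neg_inj, smul_eq_mul, mul_ite,
      mul_zero, Finset.sum_ite_eq, Finset.mem_univ, if_true] at h
    exact (mul_eq_zero.1 h).resolve_right hK
  have hspan := hli.span_eq_top_of_card_eq_finrank' (by rw [hdim, Module.finrank_linearMap])
  have hcomm : ∀ T : Module.End K V', T * A = A * T := by
    intro T
    have hT : T ∈ Submodule.span K (Set.range fun x : V => ρ (⟨x, 0⟩ : Extraspecial f)) := by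
      rw [hspan]; trivial
    induction hT using Submodule.span_induction with
    | mem T h => obtain ⟨x, rfl⟩ := h; exact hA x
    | zero => simp
    | add S T _ _ hS hT => rw [add_mul, mul_add, hS, hT]
    | smul c T _ hT => rw [smul_mul_assoc, mul_smul_comm, hT]
  have hc : A ∈ Subalgebra.center K (Module.End K V') := Subalgebra.mem_center_iff.2 hcomm
  obtain ⟨c, hc, rfl⟩ := Module.End.mem_subalgebraCenter_iff.1 hc
  exact ⟨c, rfl⟩

variable [Fintype V]

/-- Reindex by `y ↦ x + y`; the cocycle terms cancel because `g` preserves `f`. -/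
theorem rho_mul_weilOp (g : isometryGroup f) (x : V) :
    ρ ⟨x, 0⟩ * weilOp ρ g = weilOp ρ g * ρ ⟨act g x, 0⟩ := by
  rw [weilOp, mul_smul_comm, smul_mul_assoc, Finset.mul_sum, Finset.sum_mul]
  congr 1
  refine Fintype.sum_equiv (Equiv.addLeft x) _ _ fun y => ?_
  simp only [← map_mul, Equiv.coe_addLeft]
  congr 1
  rw [← mul_assoc, ← mul_inv_eq_iff_eq_mul, mul_assoc, ← mul_inv_rev]
  ext
  · simp
  · simp [act_preserves]
    ring

/-- The summand at `y` is `exp(f_g(x,x)) ρ(x,0)` with `x = y(1 - g)`, and each `x` arises from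
`|ker(1 - g)|` vectors `y`. -/
theorem weilOp_eq_sum (hfa : f.IsAlt)
    (hε : IsPrimitiveRoot ε p)
    (hρε : ∀ z : ZMod p, ρ ⟨0, z⟩ = expo ε z • (1 : Module.End K V')) (g : isometryGroup f)
    [Fintype (image g)] :
    weilOp ρ g = (Nat.card (image g) : K)⁻¹ •
      ∑ x : image g, expo ε (wallForm g x x) • ρ ⟨(x : V), 0⟩ := by
  classical
  let T : V →ₗ[ZMod p] V := LinearMap.id - act g
  obtain ⟨s, hs⟩ := T.rangeRestrict.exists_rightInverse_of_surjective T.range_rangeRestrict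
  let e := sectionEquiv T.rangeRestrict s (fun a => LinearMap.congr_fun hs a)
  have := Fintype.ofFinite (LinearMap.ker T.rangeRestrict)
  have hcard : (Fintype.card V : K) =
      Nat.card (image g) * Fintype.card (LinearMap.ker T.rangeRestrict) := by
    rw [← Fintype.card_congr e.toEquiv, Fintype.card_prod, Nat.cast_mul, Nat.card_eq_fintype_card]
  have hV : (Fintype.card V : K) ≠ 0 := by
    rw [Module.card_eq_pow_finrank (K := ZMod p), ZMod.card, Nat.cast_pow]
    exact pow_ne_zero _ (natCast_prime_ne_zero hε)
  have hsum : ∑ y : V, ρ ⟨y, 0⟩ * ρ (⟨act g y, 0⟩ : Extraspecial f)⁻¹ =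
      ∑ q : image g × LinearMap.ker T.rangeRestrict,
        expo ε (wallForm g q.1 q.1) • ρ ⟨(q.1 : V), 0⟩ := by
    refine (Fintype.sum_equiv e.toEquiv _ _ fun q => ?_).symm
    have hq : T.rangeRestrict (e q) = q.1 := by
      have h1 : T.rangeRestrict (s q.1) = q.1 := LinearMap.congr_fun hs q.1
      have h2 : T.rangeRestrict q.2 = 0 := q.2.2
      simp only [e, sectionEquiv_apply, map_add, h1, h2, add_zero]
    have hq' : e q - act g (e q) = q.1 := congrArg Subtype.val hq
    rw [wallForm_apply g (e q) q.1 q.1 hq'.symm, ← rho_eq_smul hρε, ← map_mul]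
    congr 1
    ext
    · simp [← hq', sub_eq_add_neg]
    · simp [← hq', hfa.self_eq_zero]
  rw [weilOp, hsum, Fintype.sum_prod_type]
  simp only [Finset.sum_const, Finset.card_univ]
  rw [← Finset.smul_sum, ← Nat.cast_smul_eq_nsmul K, smul_smul]
  congr 1
  have h1 := hV
  rw [hcard] at h1 ⊢
  have h2 := left_ne_zero_of_mul h1
  have h3 := right_ne_zero_of_mul h1
  field_simp

theorem natCard_submodule_ne_zero (hε : IsPrimitiveRoot ε p) (S : Submodule (ZMod p) V) :
    (Nat.card S : K) ≠ 0 := by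
  have : Fintype S := Fintype.ofFinite S
  rw [Nat.card_eq_fintype_card, Module.card_eq_pow_finrank (K := ZMod p), ZMod.card, Nat.cast_pow]
  exact pow_ne_zero _ (natCast_prime_ne_zero hε)

/-- In the double sum only the pairs `(x, -x)` have nonzero trace, and `f_h(x,x) = -f_{h⁻¹}(x,x)`.
-/
theorem trace_weilOp_mul_weilOp [FiniteDimensional K V'] (hp : Odd p) (hf : f.Nondegenerate) (hfa : f.IsAlt)
    (hε : IsPrimitiveRoot ε p)
    (hρε : ∀ z : ZMod p, ρ ⟨0, z⟩ = expo ε z • (1 : Module.End K V'))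
    (g h : isometryGroup f) [Fintype ↥(image g ⊓ image h⁻¹)] :
    LinearMap.trace K V' (weilOp ρ g * weilOp ρ h) =
      (Nat.card (image g) : K)⁻¹ * (Nat.card (image h) : K)⁻¹ *
        (∑ x : ↥(image g ⊓ image h⁻¹), expo ε (gammaForm g h x x)) *
          (Module.finrank K V' : K) := by
  classical
  have := Fintype.ofFinite (image g)
  have := Fintype.ofFinite (image h)
  rw [weilOp_eq_sum hfa hε hρε, weilOp_eq_sum hfa hε hρε, smul_mul_smul_comm, map_smul,
    smul_eq_mul, mul_assoc _ (∑ x : ↥(image g ⊓ image h⁻¹), _)]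
  congr 1
  rw [Finset.sum_mul_sum, map_sum]
  simp only [map_sum, smul_mul_smul_comm, map_smul, trace_rho_mul_rho hp hf hfa hε hρε]
  rw [← Fintype.sum_prod_type', Finset.sum_mul]
  have hmem : ∀ x : ↥(image g ⊓ image h⁻¹), (x : V) ∈ image h := fun x =>
    (image_inv h).le x.2.2
  refine (Fintype.sum_of_injective (fun x : ↥(image g ⊓ image h⁻¹) =>
    ((⟨x, x.2.1⟩, ⟨-x, neg_mem (hmem x)⟩) : image g × image h)) ?_ _ _ ?_ ?_).symm
  · intro x y hxy
    simp only [Prod.mk.injEq, Subtype.mk.injEq] at hxy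
    exact Subtype.ext hxy.1
  · rintro ⟨⟨x, hx⟩, ⟨y, hy⟩⟩ hxy
    rw [if_neg, smul_zero]
    intro h0
    obtain rfl : y = -x := h0
    refine hxy ⟨⟨x, hx, ?_⟩, rfl⟩
    rw [image_inv]
    simpa using neg_mem hy
  · intro x
    simp only [if_true, smul_eq_mul]
    congr 1
    rw [← expo_add hε.pow_eq_one]
    congr 1
    have h1 : (⟨-x, neg_mem (hmem x)⟩ : image h) = -⟨x, hmem x⟩ := rfl
    rw [gammaForm, wallForm_inv hfa h (hmem x) (hmem x), h1]
    simp

end Operators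

/-! ### The form on `I(g) × I(h)` and the splitting of `σ`. -/

section Factor

variable {p : ℕ} [Fact p.Prime] {V : Type*} [AddCommGroup V] [Module (ZMod p) V]
  {f : LinearMap.BilinForm (ZMod p) V}

/-- The form on `I(g) × I(h)` whose restriction to the antidiagonal is `γ_{g,h}`. -/
noncomputable def pairForm (g h : isometryGroup f) :
    LinearMap.BilinForm (ZMod p) (image g × image h) :=
  (wallForm g).compl₁₂ (LinearMap.fst _ _ _) (LinearMap.fst _ _ _) +
    (wallForm h).compl₁₂ (LinearMap.snd _ _ _) (LinearMap.snd _ _ _) +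
    f.compl₁₂ ((image g).subtype.comp (LinearMap.fst _ _ _))
      ((image h).subtype.comp (LinearMap.snd _ _ _))

theorem pairForm_apply (g h : isometryGroup f) (a b : image g × image h) :
    pairForm g h a b = wallForm g a.1 b.1 + wallForm h a.2 b.2 + f a.1 b.2 := rfl

theorem pairForm_sub_swap (hfa : f.IsAlt) (g h : isometryGroup f) (a b : image g × image h) :
    pairForm g h a b - pairForm g h b a = f (a.1 + a.2) (b.1 + b.2) := by
  have h1 := wallForm_sub_swap hfa g a.1 b.1
  have h2 := wallForm_sub_swap hfa h a.2 b.2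
  have h3 := alt_neg hfa (b.1 : V) a.2
  simp only [pairForm_apply, map_add, LinearMap.add_apply]
  linear_combination h1 + h2 - h3

/-- The embedding of `I(g) ∩ I(h⁻¹)` in `I(g) × I(h)` as the antidiagonal. -/
noncomputable def antidiag (g h : isometryGroup f) :
    ↥(image g ⊓ image h⁻¹) →ₗ[ZMod p] image g × image h :=
  (Submodule.inclusion inf_le_left).prod
    (-Submodule.inclusion (inf_le_right.trans (image_inv h).le))

/-- The map `u ↦ (u(1 - g), ug(1 - h))`. -/
noncomputable def pairMap (g h : isometryGroup f) : V →ₗ[ZMod p] image g × image h :=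
  (LinearMap.id - act g).rangeRestrict.prod ((LinearMap.id - act h).rangeRestrict.comp (act g))

/-- The cross term of `pairForm` cancels the contribution of `ug`. This gives both the orthogonality
to the antidiagonal and the form `f_{gh}`. -/
theorem pairForm_pairMap (g h : isometryGroup f) (u : V) (a : image g × image h) :
    pairForm g h (pairMap g h u) a = f u (a.1 + a.2) := by
  have h1 : wallForm g (pairMap g h u).1 a.1 = f u a.1 := wallForm_apply g u _ _ rfl
  have h2 : wallForm h (pairMap g h u).2 a.2 = f (act g u) a.2 :=
    wallForm_apply h (act g u) _ _ rfl
  have h3 : ((pairMap g h u).1 : V) = u - act g u := rfl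
  rw [pairForm_apply, h1, h2, h3]
  simp

theorem pairMap_add (g h : isometryGroup f) (u : V) :
    ((pairMap g h u).1 + (pairMap g h u).2 : V) = u - act (g * h) u := by
  have h1 : ((pairMap g h u).1 : V) = u - act g u := rfl
  have h2 : ((pairMap g h u).2 : V) = act g u - act h (act g u) := rfl
  rw [h1, h2, act_mul]
  abel

theorem antidiag_add (g h : isometryGroup f) (x : ↥(image g ⊓ image h⁻¹)) :
    ((antidiag g h x).1 + (antidiag g h x).2 : V) = 0 :=
  add_neg_cancel (x : V)

theorem mem_range_antidiag (g h : isometryGroup f) (a : image g × image h) :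
    a ∈ LinearMap.range (antidiag g h) ↔ (a.1 + a.2 : V) = 0 := by
  constructor
  · rintro ⟨x, rfl⟩
    exact antidiag_add g h x
  · intro h0
    have h1 : (a.2 : V) = -a.1 := eq_neg_of_add_eq_zero_right h0
    refine ⟨⟨a.1, a.1.2, ?_⟩, Prod.ext rfl (Subtype.ext h1.symm)⟩
    rw [image_inv]
    exact neg_mem_iff.1 (h1 ▸ a.2.2)

variable [Finite V]

theorem mem_range_pairMap (hf : f.Nondegenerate) (hfa : f.IsAlt) (g h : isometryGroup f)
    (a : image g × image h) :
    a ∈ LinearMap.range (pairMap g h) ↔ ∀ x, pairForm g h a (antidiag g h x) = 0 := by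
  constructor
  · rintro ⟨u, rfl⟩ x
    rw [pairForm_pairMap, antidiag_add, map_zero]
  · intro h0
    obtain ⟨⟨_, u, rfl⟩, ⟨_, v, rfl⟩⟩ := a
    -- For the pair `(u(1 - g), v(1 - h))`, orthogonality to the antidiagonal says `ug - v ⟂ I(g) ∩
    -- I(h)`. Then `u - b` is a preimage: `b` is fixed by `g`, and `(u - b)g = v + c` with `c` fixed
    -- by `h`.
    obtain ⟨b, c, hb, hc, hbc⟩ := exists_add_of_orthogonal hf hfa g h (act g u - v) (by
      rintro x ⟨hx, hx'⟩
      have h1 := h0 ⟨x, hx, by rwa [image_inv]⟩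
      rw [pairForm_apply, wallForm_apply g u _ _ rfl, wallForm_apply h v _ _ rfl] at h1
      have h2 : f u x + f v (-x) + f (u - act g u) (-x) = 0 := h1
      simp only [map_neg, map_sub, LinearMap.sub_apply] at h2 ⊢
      linear_combination h2)
    have h3 : act g u - b = v + c := by rw [sub_eq_iff_eq_add, add_assoc, add_comm c, ← hbc]; abel
    refine ⟨u - b, Prod.ext (Subtype.ext ?_) (Subtype.ext ?_)⟩
    · change u - b - act g (u - b) = u - act g u
      rw [map_sub, hb]
      abel
    · change act g (u - b) - act h (act g (u - b)) = v - act h v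
      rw [map_sub, hb, h3, map_add, hc]
      abel

variable {K : Type*} [Field K] {ε : K}

theorem splitting_eq (h : ε ^ p = 1) (g : isometryGroup f) :
    splitting ε g =
      (Nat.card (image g) : K)⁻¹ * gaussWeight (AddChar.zmodChar p h) (wallForm g) := by
  have h1 : gaussSum p ε = sqSum (AddChar.zmodChar p h) := by
    simp only [gaussSum, sqSum, zmodChar_eq_expo]
  rw [splitting, h1, mul_assoc]
  rfl

/-- `sum_mul_gaussWeight` for `pairForm` and the antidiagonal, with `Y = V` and `P = I(gh)`. -/
theorem sum_expo_mul_gaussWeight (hp : Odd p) (hf : f.Nondegenerate) (hfa : f.IsAlt)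
    (hε : IsPrimitiveRoot ε p) (g h : isometryGroup f) [Fintype ↥(image g ⊓ image h⁻¹)] :
    (∑ x : ↥(image g ⊓ image h⁻¹), expo ε (gammaForm g h x x)) *
        gaussWeight (AddChar.zmodChar p hε.pow_eq_one) (wallForm (g * h)) =
      gaussWeight (AddChar.zmodChar p hε.pow_eq_one) (wallForm g) *
        gaussWeight (AddChar.zmodChar p hε.pow_eq_one) (wallForm h) := by
  have hC : ∀ x y, pairForm g h (LinearEquiv.refl (ZMod p) _ (x, 0))
      (LinearEquiv.refl (ZMod p) _ (y, 0)) = wallForm g x y := fun x y => by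
    simp [pairForm_apply]
  have hD : ∀ x y, pairForm g h (LinearEquiv.refl (ZMod p) _ (0, x))
      (LinearEquiv.refl (ZMod p) _ (0, y)) = wallForm h x y := fun x y => by
    simp [pairForm_apply]
  have h0 : ∀ x y, pairForm g h (LinearEquiv.refl (ZMod p) _ (0, x))
      (LinearEquiv.refl (ZMod p) _ (y, 0)) = 0 := fun x y => by
    simp [pairForm_apply]
  rw [← gaussWeight_of_prod _ _ hC hD h0]
  have hB := nondegenerate_prod _ hC hD h0 (wallForm_nondegenerate hf g)
    (wallForm_nondegenerate hf h)
  have hψ := AddChar.zmodChar_primitive_of_primitive_root p hε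
  rw [← sum_mul_gaussWeight (ringChar_zmod_ne_two hp) hψ hB (antidiag g h) ?_ ?_ (pairMap g h)
    (mem_range_pairMap hf hfa g h) (LinearMap.id - act (g * h)).rangeRestrict
    (LinearMap.surjective_rangeRestrict _) ?_ (wallForm (g * h)) ?_]
  · congr 1
    refine Finset.sum_congr rfl fun x _ => ?_
    rw [zmodChar_eq_expo]
    congr 1
    have hx : (x : V) ∈ image h := (image_inv h).le x.2.2
    have h1 : antidiag g h x = (⟨x, x.2.1⟩, -⟨x, hx⟩) := rfl
    rw [gammaForm, wallForm_inv hfa h hx hx, pairForm_apply, h1]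
    simp [hfa.self_eq_zero]
  · intro x y hxy
    exact Subtype.ext (congrArg (fun a => (a.1 : V)) hxy)
  · intro x a
    have := pairForm_sub_swap hfa g h a (antidiag g h x)
    rw [antidiag_add, map_zero] at this
    exact sub_eq_zero.1 this
  · intro u
    rw [mem_range_antidiag, pairMap_add]
    exact Subtype.ext_iff
  · intro u v
    rw [pairForm_pairMap, wallForm_apply (g * h) u _ _ rfl, pairMap_add]
    rfl

theorem splitting_ne_zero (hp : Odd p) (hf : f.Nondegenerate) (hε : IsPrimitiveRoot ε p)
    (g : isometryGroup f) : splitting ε g ≠ 0 := by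
  have := Fintype.ofFinite V
  rw [splitting_eq hε.pow_eq_one]
  refine mul_ne_zero (inv_ne_zero (natCard_submodule_ne_zero hε _))
    (gaussWeight_ne_zero (ringChar_zmod_ne_two hp)
      (AddChar.zmodChar_primitive_of_primitive_root p hε) ?_ (wallForm_nondegenerate hf g))
  rw [ZMod.card]
  exact natCast_prime_ne_zero hε

theorem factorSet_eq (hp : Odd p) (hf : f.Nondegenerate) (hfa : f.IsAlt)
    (hε : IsPrimitiveRoot ε p) (g h : isometryGroup f) :
    factorSet ε g h = splitting ε g * splitting ε h * (splitting ε (g * h))⁻¹ := by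
  have := Fintype.ofFinite V
  have := Fintype.ofFinite ↥(image g ⊓ image h⁻¹)
  rw [eq_mul_inv_iff_mul_eq₀ (splitting_ne_zero hp hf hε _), factorSet,
    finsum_eq_sum_of_fintype, splitting_eq hε.pow_eq_one, splitting_eq hε.pow_eq_one,
    splitting_eq hε.pow_eq_one]
  have h1 := sum_expo_mul_gaussWeight hp hf hfa hε g h
  have h2 := mul_inv_cancel₀ (natCard_submodule_ne_zero hε (image (g * h)))
  linear_combination (Nat.card (image g) : K)⁻¹ * (Nat.card (image h) : K)⁻¹ * h1 +
    (Nat.card (image g) : K)⁻¹ * (Nat.card (image h) : K)⁻¹ *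
      (∑ x : ↥(image g ⊓ image h⁻¹), expo ε (gammaForm g h x x)) *
        gaussWeight (AddChar.zmodChar p hε.pow_eq_one) (wallForm (g * h)) * h2

theorem wallSign_inv (hfa : f.IsAlt) (g : isometryGroup f) :
    wallSign g⁻¹ = quadraticChar (ZMod p) (-1) ^ imageDim g * wallSign g := by
  let b := Module.finBasis (ZMod p) (image g)
  let e : image g ≃ₗ[ZMod p] image g⁻¹ := LinearEquiv.ofEq _ _ (image_inv g).symm
  have h : LinearMap.BilinForm.toMatrix (b.map e) (wallForm g⁻¹) =
      -(LinearMap.BilinForm.toMatrix b (wallForm g)).transpose := by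
    ext i j
    simp only [LinearMap.BilinForm.toMatrix_apply, Module.Basis.map_apply, Matrix.neg_apply,
      Matrix.transpose_apply]
    exact wallForm_inv hfa g (b i).2 (b j).2 _ _
  rw [wallSign_eq g⁻¹ (b.map e), h, Matrix.det_neg, Matrix.det_transpose, map_mul, map_pow,
    Fintype.card_fin]
  rfl

/-- `η` replaces `a²` by `-a²` in the exponent. -/
theorem map_gaussSum (hp : Odd p) (hε : IsPrimitiveRoot ε p) (η : K ≃+* K) (hη : η ε = ε⁻¹) :
    η (gaussSum p ε) = (quadraticChar (ZMod p) (-1) : K) * gaussSum p ε := by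
  have hψ := AddChar.zmodChar_primitive_of_primitive_root p hε
  have h1 : gaussSum p ε = sqSum (AddChar.zmodChar p hε.pow_eq_one) := by
    simp only [gaussSum, sqSum, zmodChar_eq_expo]
  rw [h1, ← sum_mul_sq (ringChar_zmod_ne_two hp) hψ (by simp : (-1 : ZMod p) ≠ 0), ← h1,
    gaussSum, map_sum]
  refine Finset.sum_congr rfl fun a _ => ?_
  rw [neg_one_mul, AddChar.map_neg_eq_inv, zmodChar_eq_expo, expo, map_pow, hη, inv_pow]

/-- The sign `χ(-1) ^ i(g)` occurs twice and cancels: once from `η θ`, once from `f_{g⁻¹}` being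
minus the transpose of `f_g`. -/
theorem splitting_eq_map_inv (hp : Odd p) (hfa : f.IsAlt) (hε : IsPrimitiveRoot ε p)
    (η : K ≃+* K) (hη : η ε = ε⁻¹) (g : isometryGroup f) :
    splitting ε g = η (splitting ε g⁻¹) := by
  have h1 : imageDim g⁻¹ = imageDim g := by rw [imageDim, imageDim, image_inv]
  have h2 : ((quadraticChar (ZMod p) (-1) : ℤ) : K) ^ imageDim g *
      ((quadraticChar (ZMod p) (-1) : ℤ) : K) ^ imageDim g = 1 := by
    rw [← mul_pow, quadraticChar_cast_mul_self (by simp), one_pow]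
  rw [splitting, splitting, map_mul, map_mul, map_pow, map_inv₀, map_natCast, map_intCast,
    map_gaussSum hp hε η hη, wallSign_inv hfa, h1, image_inv]
  push_cast
  rw [mul_pow]
  linear_combination -(Nat.card (image g) : K)⁻¹ * gaussSum p ε ^ imageDim g * wallSign g * h2

end Factor

/-! ### Invertibility of `s(g)` and its factor set. -/

section Projective

variable {p : ℕ} [Fact p.Prime] {V : Type*} [AddCommGroup V] [Module (ZMod p) V] [Fintype V]
  {f : LinearMap.BilinForm (ZMod p) V}
  {K V' : Type*} [Field K] [AddCommGroup V'] [Module K V'] [FiniteDimensional K V']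
  {ρ : Representation K (Extraspecial f) V'} {ε : K}

theorem trace_weilOp (hp : Odd p) (hf : f.Nondegenerate) (hfa : f.IsAlt)
    (hε : IsPrimitiveRoot ε p)
    (hρε : ∀ z : ZMod p, ρ ⟨0, z⟩ = expo ε z • (1 : Module.End K V')) (g : isometryGroup f) :
    LinearMap.trace K V' (weilOp ρ g) =
      (Nat.card (image g) : K)⁻¹ * (Module.finrank K V' : K) := by
  have := Fintype.ofFinite (image g)
  rw [weilOp_eq_sum hfa hε hρε, map_smul, map_sum, Fintype.sum_eq_single 0]
  · rw [map_smul, map_zero, expo_zero, one_smul, smul_eq_mul]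
    congr 1
    exact (congrArg (LinearMap.trace K V') (map_one ρ)).trans (LinearMap.trace_one K V')
  · intro x hx
    rw [map_smul, trace_rho hp hf hfa hε hρε, smul_zero]
    exact fun h => hx (Subtype.ext h)

/-- `s(g)s(g⁻¹)` is a scalar, and its trace is nonzero because `γ_{g,g⁻¹}` vanishes on the diagonal.
-/
theorem isUnit_weilOp (hp : Odd p) (hf : f.Nondegenerate) (hfa : f.IsAlt)
    (hε : IsPrimitiveRoot ε p)
    (hρε : ∀ z : ZMod p, ρ ⟨0, z⟩ = expo ε z • (1 : Module.End K V'))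
    (hK : (Module.finrank K V' : K) ≠ 0)
    (hdim : Fintype.card V = Module.finrank K V' * Module.finrank K V') (g : isometryGroup f) :
    IsUnit (weilOp ρ g) := by
  obtain ⟨c, hc⟩ := exists_eq_smul_of_commute hp hf hfa hε hρε hK hdim
    (A := weilOp ρ g * weilOp ρ g⁻¹) fun x => by
      rw [← mul_assoc, rho_mul_weilOp, mul_assoc, rho_mul_weilOp, act_inv_act, mul_assoc]
  have := Fintype.ofFinite ↥(image g ⊓ image g⁻¹⁻¹)
  have ht := trace_weilOp_mul_weilOp hp hf hfa hε hρε g g⁻¹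
  have hsum : ∑ x : ↥(image g ⊓ image g⁻¹⁻¹), expo ε (gammaForm g g⁻¹ x x) =
      (Nat.card ↥(image g ⊓ image g⁻¹⁻¹) : K) := by
    rw [Nat.card_eq_fintype_card, ← Finset.card_univ, Finset.card_eq_sum_ones, Nat.cast_sum]
    refine Finset.sum_congr rfl fun x _ => ?_
    have hx : (x : V) ∈ image g⁻¹ := (image_inv g).ge x.2.1
    rw [gammaForm, wallForm_inv hfa g⁻¹ hx hx, wallForm_inv hfa g x.2.1 x.2.1]
    simp [expo_zero]
  have hc0 : c ≠ 0 := by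
    rintro rfl
    rw [hc, zero_smul, map_zero, hsum] at ht
    refine mul_ne_zero (mul_ne_zero (mul_ne_zero ?_ ?_) ?_) hK ht.symm
    · exact inv_ne_zero (natCard_submodule_ne_zero hε _)
    · exact inv_ne_zero (natCard_submodule_ne_zero hε _)
    · exact natCard_submodule_ne_zero hε _
  have h1 : weilOp ρ g * (c⁻¹ • weilOp ρ g⁻¹) = 1 := by
    rw [mul_smul_comm, hc, smul_smul, inv_mul_cancel₀ hc0, one_smul]
  exact IsUnit.of_mul_eq_one _ h1

theorem weilOp_mul_weilOp (hp : Odd p) (hf : f.Nondegenerate) (hfa : f.IsAlt)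
    (hε : IsPrimitiveRoot ε p)
    (hρε : ∀ z : ZMod p, ρ ⟨0, z⟩ = expo ε z • (1 : Module.End K V'))
    (hK : (Module.finrank K V' : K) ≠ 0)
    (hdim : Fintype.card V = Module.finrank K V' * Module.finrank K V')
    (g h : isometryGroup f) :
    weilOp ρ g * weilOp ρ h = factorSet ε g h • weilOp ρ (g * h) := by
  obtain ⟨u, hu⟩ := isUnit_weilOp hp hf hfa hε hρε hK hdim (g * h)
  have hinv : ∀ x, ρ ⟨act (g * h) x, 0⟩ * (↑u⁻¹ : Module.End K V') = ↑u⁻¹ * ρ ⟨x, 0⟩ := by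
    intro x
    rw [Units.eq_inv_mul_iff_mul_eq, ← mul_assoc, Units.mul_inv_eq_iff_eq_mul, hu,
      rho_mul_weilOp]
  obtain ⟨c, hc⟩ := exists_eq_smul_of_commute hp hf hfa hε hρε hK hdim
    (A := weilOp ρ g * weilOp ρ h * ↑u⁻¹) fun x => by
      rw [← mul_assoc, ← mul_assoc, rho_mul_weilOp, mul_assoc (weilOp ρ g), rho_mul_weilOp,
        ← act_mul, mul_assoc (weilOp ρ g * weilOp ρ h) _ (ρ ⟨x, 0⟩), ← hinv]
      simp only [mul_assoc]
  rw [Units.mul_inv_eq_iff_eq_mul, smul_mul_assoc, one_mul, hu] at hc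
  rw [hc]
  congr 1
  -- The scalar is found by comparing traces: that of `s(gh)` is `|I(gh)|⁻¹ dim V'`, which is
  -- nonzero.
  have := Fintype.ofFinite ↥(image g ⊓ image h⁻¹)
  have ht := trace_weilOp_mul_weilOp hp hf hfa hε hρε g h
  rw [hc, map_smul, trace_weilOp hp hf hfa hε hρε, smul_eq_mul, ← mul_assoc] at ht
  have h1 := mul_right_cancel₀ hK ht
  rw [← div_eq_mul_inv, div_eq_iff (natCard_submodule_ne_zero hε _)] at h1
  rw [h1, factorSet, finsum_eq_sum_of_fintype]
  ring

end Projective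

end Weil

theorem mainTheorem1 {p : ℕ} [Fact p.Prime] (hp : Odd p)
    {V : Type*} [AddCommGroup V] [Module (ZMod p) V] [Fintype V]
    (f : LinearMap.BilinForm (ZMod p) V) (hf : f.Nondegenerate) (hfalt : f.IsAlt)
    (n : ℕ) (hn : Module.finrank (ZMod p) V = 2 * n)
    {K V' : Type*} [Field K] [AddCommGroup V'] [Module K V']
    (hV' : Module.finrank K V' = p ^ n)
    (ρ : Representation K (Weil.Extraspecial f) V') (hρ : Weil.IsAbsolutelyIrreducible ρ)
    (ε : K) (hε : IsPrimitiveRoot ε p)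
    (hρε : ∀ z : ZMod p, ρ ⟨0, z⟩ = Weil.expo ε z • (1 : Module.End K V')) :
    -- `σ` is the factor set of the projective representation `g ↦ s(g)`
    ((∀ g : Weil.isometryGroup f, IsUnit (Weil.weilOp ρ g)) ∧
      ∀ g h : Weil.isometryGroup f,
        Weil.weilOp ρ g * Weil.weilOp ρ h = Weil.factorSet ε g h • Weil.weilOp ρ (g * h)) ∧
    -- `μ` splits `σ`
    ((∀ g : Weil.isometryGroup f, Weil.splitting ε g ≠ 0) ∧
      ∀ g h : Weil.isometryGroup f,
        Weil.factorSet ε g h =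
          Weil.splitting ε g * Weil.splitting ε h * (Weil.splitting ε (g * h))⁻¹) ∧
    -- compatibility with the automorphisms that invert `ε`
    (∀ η : K ≃+* K, η ε = ε⁻¹ →
      ∀ g : Weil.isometryGroup f, Weil.splitting ε g = η (Weil.splitting ε g⁻¹)) := by
  have hp0 : 0 < p := (Fact.out : p.Prime).pos
  have : FiniteDimensional K V' := FiniteDimensional.of_finrank_pos (by rw [hV']; positivity)
  have hK : (Module.finrank K V' : K) ≠ 0 := by
    rw [hV', Nat.cast_pow]
    exact pow_ne_zero _ (Weil.natCast_prime_ne_zero hε)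
  -- `p ^ (2n) = (p ^ n)²`: there are as many operators `ρ(x,0)` as `dim End V'`.
  have hdim : Fintype.card V = Module.finrank K V' * Module.finrank K V' := by
    rw [Module.card_eq_pow_finrank (K := ZMod p), ZMod.card, hn, hV', ← pow_add, two_mul]
  exact ⟨⟨Weil.isUnit_weilOp hp hf hfalt hε hρε hK hdim,
      Weil.weilOp_mul_weilOp hp hf hfalt hε hρε hK hdim⟩,
    ⟨Weil.splitting_ne_zero hp hf hε, Weil.factorSet_eq hp hf hfalt hε⟩,
    Weil.splitting_eq_map_inv hp hfalt hε⟩
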